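/- Definitions. An unfair metrical task system (UMTS) $U=(M;r_1,\dots,r_b)$ consists of a metric space $M=\{v_1,\dots,v_b\}$ and cost ratios $r_1,\dots,r_b>0$. A task is a vector $(c_1,\dots,c_b)$ of nonnegative costs; serving it by moving from $v_i$ to $v_j$ costs an online algorithm $d(v_i,v_j)+r_jc_j$ and costs an offline algorithm $d(v_i,v_j)+c_j$. An online algorithm chooses each point from its starting point and the tasks seen so far, including the current one. The elementary task $(v,\delta)$ has cost $\delta$ at $v$ and $0$ elsewhere. Write $\mathrm{cost}_A(\sigma,u_0)$ for the cost of the online algorithm $A$ on the task sequence $\sigma$ when started at $u_0$, and $\mathrm{cost}_{\mathrm{OPT}^0}(\sigma,u_0)$ for the minimum offline cost of serving $\sigma$ from $u_0$ and then returning to $u_0$. Let $\Delta>0$ be the diameter of $M$. For $\beta>0$, an $(r,\beta)$-adversary is a probability distribution $\mathcal D$ on finite sequences of elementary tasks such that $$\min_{u_0}\mathrm E_{\sigma\in\mathcal D}[\mathrm{cost}_{\mathrm{OPT}^0}(\sigma,u_0)]\le\beta\Delta\quad\text{and}\quad \min_{u_0}\mathrm E_{\sigma\in\mathcal D}[\mathrm{cost}_A(\sigma,u_0)]\ge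 r\beta\Delta$$ for every deterministic online algorithm $A$. It is an $(r,\beta;\alpha_1,\dots,\alpha_b)$-discrete adversary if it uses only tasks of the form $(v_i,\alpha_i\Delta)$. Let $\mathcal U_b^\Delta$ be the uniform metric space on $b$ points in which all distances between distinct points equal $\Delta>0$. Statement. There exist constants $\lambda_3,\rho>0$ such that for every $b\ge2$, every $\Delta>0$ and every UMTS $U=(\mathcal U_b^\Delta;r_1,\dots,r_b)$ with $r_1\ge r_2\ge\cdots\ge r_b\ge1$ the following hold. (a) If $r_1\ge\frac14\ln b$, then there is an $(r,\beta;r_1^{-1},\dots,r_b^{-1})$-discrete adversary for $U$ with $\beta\le\lambda_3r_1$ and $r\ge\rho\ln\bigl(\sum_{i=1}^b e^{\rho^{-1}r_i}\bigr)$. (b) If $n_1,\dots,n_b>0$ satisfy $r_i=\rho(1+\ln n_i)$ for all $i$, then there is an $(r,\beta;\alpha_1,\dots,\alpha_b)$-discrete adversary for $U$ with $r\ge\rho\bigl(1+\ln\sum_{i=1}^b n_i\bigr)$, $\beta\le\lambda_3r_1$ and $\min_i\alpha_i\ge r_1^{-1}$. -/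

import Mathlib

open scoped NNReal ENNReal

noncomputable section

/-- A task on `b` points assigns a nonnegative processing cost to every point. Infinite costs, which
no discrete adversary uses, are left out. -/
abbrev TaskVec (b : ℕ) : Type := Fin b → ℝ≥0

/-- The elementary task `(v, δ)`: cost `δ` at the point `v` and `0` at every other point. -/
structure ElementaryTask (b : ℕ) where
  point : Fin b
  size : ℝ≥0

/-- The elementary task `(v, δ)` as a vector of processing costs. -/
def ElementaryTask.toTask {b : ℕ} (e : ElementaryTask b) : TaskVec b :=
  Pi.single e.point e.size

/-- An unfair metrical task system `(M; r₁, …, r_b; s)`: a metric on `b` points, positive cost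
ratios and a positive distance ratio. -/
structure UMTS (b : ℕ) where
  metric : MetricSpace (Fin b)
  costRatio : Fin b → ℝ
  costRatio_pos : ∀ i, 0 < costRatio i
  distRatio : ℝ
  distRatio_pos : 0 < distRatio

namespace UMTS

variable {b : ℕ} (U : UMTS b)

/-- The distance between two points of the system. -/
def d (i j : Fin b) : ℝ := U.metric.dist i j

/-- The diameter of the underlying metric space. -/
def diam : ℝ := @Metric.diam (Fin b) U.metric.toPseudoMetricSpace Set.univ

/-- The underlying metric space is uniform: distinct points are at distance `Δ`. -/
def IsUniform (Δ : ℝ) : Prop := ∀ i j : Fin b, i ≠ j → U.d i j = Δ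

/-- The offline (fair) cost of being at the point `p t` after the `t`-th task of `σ`, where
`p 0` is the initial point. -/
def offlineCost (σ : List (TaskVec b)) (p : ℕ → Fin b) : ℝ :=
  ∑ t : Fin σ.length, (U.d (p t) (p (t + 1)) + (σ.get t (p (t + 1)) : ℝ))

/-- The online (unfair) cost of being at the point `p t` after the `t`-th task of `σ`, where
`p 0` is the initial point. -/
def onlineCost (σ : List (TaskVec b)) (p : ℕ → Fin b) : ℝ :=
  ∑ t : Fin σ.length, (U.distRatio * U.d (p t) (p (t + 1)) +
    U.costRatio (p (t + 1)) * (σ.get t (p (t + 1)) : ℝ))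

/-- The optimal offline cost of serving `σ` from `u₀` and then returning to `u₀`. -/
def opt0 (σ : List (TaskVec b)) (u₀ : Fin b) : ℝ :=
  ⨅ p : {p : ℕ → Fin b // p 0 = u₀}, (U.offlineCost σ p.1 + U.d (p.1 σ.length) u₀)

end UMTS

/-- A deterministic online algorithm: `state u₀ τ` is the point occupied after the tasks `τ` have
been received and served, when the initial point is `u₀`. -/
structure OnlineAlgorithm (b : ℕ) where
  state : Fin b → List (TaskVec b) → Fin b
  state_nil : ∀ u₀, state u₀ [] = u₀

namespace UMTS

variable {b : ℕ} (U : UMTS b)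

/-- The cost of the online algorithm `A` on `σ` when it starts at `u₀`. -/
def algCost (A : OnlineAlgorithm b) (σ : List (TaskVec b)) (u₀ : Fin b) : ℝ :=
  U.onlineCost σ fun t => A.state u₀ (σ.take t)

end UMTS

/-- The expectation of a nonnegative cost when a sequence of elementary tasks is drawn
from `D`. It is taken in `[0, ∞]`, so that no integrability question arises. -/
def expectedCost {b : ℕ} (D : PMF (List (ElementaryTask b))) (cost : List (TaskVec b) → ℝ) : ℝ≥0∞ :=
  ∑' σ, D σ * ENNReal.ofReal (cost (σ.map ElementaryTask.toTask))

namespace UMTS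

variable {b : ℕ} (U : UMTS b)

/-- `D` is an `(r, β)`-adversary for `U`. The scale `β` is positive: with `β = 0` the empty task
sequence would be an `(r, 0)`-adversary for every `r`. -/
structure IsAdversary (r β : ℝ) (D : PMF (List (ElementaryTask b))) : Prop where
  diam_pos : 0 < U.diam
  beta_pos : 0 < β
  offline_le : ⨅ u₀, expectedCost D (fun σ => U.opt0 σ u₀) ≤ ENNReal.ofReal (β * U.diam)
  le_online : ∀ A : OnlineAlgorithm b,
    ENNReal.ofReal (r * (β * U.diam)) ≤ ⨅ u₀, expectedCost D (fun σ => U.algCost A σ u₀)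

/-- `D` is an `(r, β; α₁, …, α_b)`-discrete adversary for `U`: an `(r, β)`-adversary all of whose
tasks have the form `(vᵢ, αᵢ Δ)`, with `Δ` the diameter. There are finitely many such tasks, hence
countably many task sequences, so a `PMF` is here the general notion of a distribution. -/
structure IsDiscreteAdversary (r β : ℝ) (α : Fin b → ℝ) (D : PMF (List (ElementaryTask b))) :
    Prop extends U.IsAdversary r β D where
  size_eq : ∀ σ ∈ D.support, ∀ e ∈ σ, (e.size : ℝ) = α e.point * U.diam

end UMTS

end

/-! All bounds come from one kind of random sequence: in each of `K` rounds every point is hit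
independently with probability 1/2, a hit at a point of ratio `r_i` having size `Δ / r_i` and hence
online cost `Δ`. An online algorithm pays at least `Δ / 2` per round on average
(`IsUniform.le_avg_walkCost`): it either leaves its point or meets a fair coin there. Offline,
staying at the first point costs `K Δ / (2 R)` on average, where `R` is the largest ratio; this
alone gives the ratio `R`. The excess over `R` comes from fluctuations: if the first point is hit
often and one of the next `k` points rarely, moving there saves at least `Δ`
(`IsUniform.exists_adversary_of_tails`).

The log-sum target is reduced to a single index `k` (`exists_sum_le_add_sq_mul`): one must gain `ρ
log (1 + (k + 1) ^ 2 exp (-x / ρ))` over `R`, where `x` is the deficit of the ratio at `k`. Taking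
`K = s * B` with `B` about `(32 R / s) ^ 2`, a point lies `4 R` hits below the mean with probability
at least `17 ^ (-s)`, and a saving is worth order `s` in the ratio
(`IsUniform.exists_adversary_of_blocks`). Choosing `s` of order `log (k + 1)` or of order `x`
suffices unless `x` is comparable to `R`; then the required gain is so small that the event "first
point always hit, second never" provides it (`IsUniform.exists_adversary_of_extremes`).

If `log b` exceeds `50 R`, take about `log b / 2` rounds instead: some point is probably never hit,
so the offline cost is at most `3 Δ` and the ratio is of order `log b`. -/

/-! ### Binomial averages and tail bounds -/

/-- The average of `g` over a binomial variable with `n` fair coins. -/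
noncomputable def binAvg : ℕ → (ℕ → ℝ) → ℝ
  | 0, g => g 0
  | n + 1, g => (binAvg n g + binAvg n fun k => g (k + 1)) / 2

theorem binAvg_mono (n : ℕ) {g h : ℕ → ℝ} (H : ∀ k, g k ≤ h k) : binAvg n g ≤ binAvg n h := by
  induction n generalizing g h with
  | zero => exact H 0
  | succ n ih =>
    have h1 := ih H
    have h2 := ih fun k => H (k + 1)
    simp only [binAvg]
    linarith

theorem binAvg_const (n : ℕ) (c : ℝ) : binAvg n (fun _ => c) = c := by
  induction n with
  | zero => rfl
  | succ n ih => simp only [binAvg, ih]; ring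

theorem binAvg_add (n : ℕ) (g h : ℕ → ℝ) :
    binAvg n (fun k => g k + h k) = binAvg n g + binAvg n h := by
  induction n generalizing g h with
  | zero => rfl
  | succ n ih => simp only [binAvg, ih]; ring

theorem binAvg_mul_left (n : ℕ) (c : ℝ) (g : ℕ → ℝ) :
    binAvg n (fun k => c * g k) = c * binAvg n g := by
  induction n generalizing g with
  | zero => rfl
  | succ n ih => simp only [binAvg, ih]; ring

theorem binAvg_const_sub (n : ℕ) (c : ℝ) (g : ℕ → ℝ) :
    binAvg n (fun k => c - g k) = c - binAvg n g := by
  have h : (fun k => c - g k) = fun k => (fun _ => c) k + (-1) * g k := by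
    funext k; ring
  rw [h, binAvg_add, binAvg_const, binAvg_mul_left]
  ring

theorem binAvg_nat_add (m n : ℕ) (g : ℕ → ℝ) :
    binAvg (m + n) g = binAvg m fun a => binAvg n fun b => g (a + b) := by
  induction m generalizing g with
  | zero => simp [binAvg]
  | succ m ih =>
    rw [Nat.succ_add]
    simp only [binAvg, ih]
    congr 3
    funext a
    congr 1
    funext b
    congr 1
    ring

theorem binAvg_linear (n : ℕ) (c : ℝ) :
    binAvg n (fun k => (2 * (k : ℝ) + c)) = n + c := by
  induction n generalizing c with
  | zero => simp [binAvg]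
  | succ n ih =>
    have h : (fun k : ℕ => 2 * ((k + 1 : ℕ) : ℝ) + c) = fun k : ℕ => 2 * (k : ℝ) + (c + 2) := by
      funext k; push_cast; ring
    simp only [binAvg]
    rw [h, ih, ih]
    push_cast
    ring

theorem binAvg_cast (n : ℕ) : binAvg n (fun k => (k : ℝ)) = n / 2 := by
  have h := binAvg_linear n 0
  simp only [add_zero] at h
  rw [binAvg_mul_left] at h
  linarith

/-- The average of a quartic polynomial in the centred and doubled binomial variable. -/
theorem binAvg_quartic (n : ℕ) (a₀ a₁ a₂ a₃ a₄ : ℝ) :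
    binAvg n (fun k => a₀ + a₁ * (2 * (k : ℝ) - n) + a₂ * (2 * (k : ℝ) - n) ^ 2
      + a₃ * (2 * (k : ℝ) - n) ^ 3 + a₄ * (2 * (k : ℝ) - n) ^ 4)
      = a₀ + a₂ * n + a₄ * (3 * n ^ 2 - 2 * n) := by
  induction n generalizing a₀ a₁ a₂ a₃ a₄ with
  | zero => simp [binAvg]
  | succ n ih =>
    -- One coin moves the centred variable by -1 or +1; these are the coefficients of the polynomial
    -- re-expanded after either shift.
    have h1 := ih (a₀ - a₁ + a₂ - a₃ + a₄) (a₁ - 2 * a₂ + 3 * a₃ - 4 * a₄)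
      (a₂ - 3 * a₃ + 6 * a₄) (a₃ - 4 * a₄) a₄
    have h2 := ih (a₀ + a₁ + a₂ + a₃ + a₄) (a₁ + 2 * a₂ + 3 * a₃ + 4 * a₄)
      (a₂ + 3 * a₃ + 6 * a₄) (a₃ + 4 * a₄) a₄
    simp only [binAvg]
    have e1 : (fun k : ℕ => a₀ + a₁ * (2 * (k : ℝ) - ((n + 1 : ℕ) : ℝ))
        + a₂ * (2 * (k : ℝ) - ((n + 1 : ℕ) : ℝ)) ^ 2 + a₃ * (2 * (k : ℝ) - ((n + 1 : ℕ) : ℝ)) ^ 3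
        + a₄ * (2 * (k : ℝ) - ((n + 1 : ℕ) : ℝ)) ^ 4) = fun k : ℕ =>
        (a₀ - a₁ + a₂ - a₃ + a₄) + (a₁ - 2 * a₂ + 3 * a₃ - 4 * a₄) * (2 * (k : ℝ) - n)
        + (a₂ - 3 * a₃ + 6 * a₄) * (2 * (k : ℝ) - n) ^ 2
        + (a₃ - 4 * a₄) * (2 * (k : ℝ) - n) ^ 3 + a₄ * (2 * (k : ℝ) - n) ^ 4 := by
      funext k; push_cast; ring
    have e2 : (fun k : ℕ => a₀ + a₁ * (2 * ((k + 1 : ℕ) : ℝ) - ((n + 1 : ℕ) : ℝ))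
        + a₂ * (2 * ((k + 1 : ℕ) : ℝ) - ((n + 1 : ℕ) : ℝ)) ^ 2
        + a₃ * (2 * ((k + 1 : ℕ) : ℝ) - ((n + 1 : ℕ) : ℝ)) ^ 3
        + a₄ * (2 * ((k + 1 : ℕ) : ℝ) - ((n + 1 : ℕ) : ℝ)) ^ 4) = fun k : ℕ =>
        (a₀ + a₁ + a₂ + a₃ + a₄) + (a₁ + 2 * a₂ + 3 * a₃ + 4 * a₄) * (2 * (k : ℝ) - n)
        + (a₂ + 3 * a₃ + 6 * a₄) * (2 * (k : ℝ) - n) ^ 2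
        + (a₃ + 4 * a₄) * (2 * (k : ℝ) - n) ^ 3 + a₄ * (2 * (k : ℝ) - n) ^ 4 := by
      funext k; push_cast; ring
    rw [e1, e2, h1, h2]
    push_cast
    ring

/-- A fourth-moment witness: the quartic is nonpositive left of 1/4 and never exceeds 17, while its
mean at a normalized binomial is `1 + 2 / n`. Hence the tail beyond 1/4 has probability at least
1/17. -/
theorem quartic_le_indicator (z : ℝ) :
    (z + 1) ^ 2 * (z - 1 / 4) * (3 - z) ≤ if 1 / 4 ≤ z then 17 else 0 := by
  split_ifs with h
  · nlinarith [sq_nonneg (z ^ 2 - z / 2 - 37 / 10), sq_nonneg (z - 11 / 5), sq_nonneg z,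
      sq_nonneg (z ^ 2 - 5)]
  · push Not at h
    have : 0 ≤ (z + 1) ^ 2 * ((1 / 4 - z) * (3 - z)) := by
      apply mul_nonneg (sq_nonneg _)
      apply mul_nonneg <;> linarith
    nlinarith

/-- The tail of a signed, normalized binomial variable at a quarter of the standard deviation. -/
theorem binAvg_tail (n : ℕ) (hn : 0 < n) (ε : ℝ) (hε : ε ^ 2 = 1) :
    1 / 17 ≤ binAvg n fun k => if √n / 4 ≤ ε * (2 * (k : ℝ) - n) then 1 else 0 := by
  have hn' : (0 : ℝ) < n := by exact_mod_cast hn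
  have hq : 0 < √(n : ℝ) := Real.sqrt_pos.2 hn'
  obtain ⟨q, hqq⟩ : ∃ q, q = √(n : ℝ) := ⟨_, rfl⟩
  have hq2 : q ^ 2 = n := by rw [hqq]; exact Real.sq_sqrt hn'.le
  rw [← hqq] at hq ⊢
  have hq0 : q ≠ 0 := hq.ne'
  have h4 : ε ^ 4 = 1 := by rw [show ε ^ 4 = (ε ^ 2) ^ 2 by ring, hε]; norm_num
  -- The quartic at `z = ε (2k - n) / √n`, expanded in powers of `2k - n`. The sign `ε` selects the
  -- upper or the lower tail and survives only in the odd terms, whose means vanish.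
  have key : ∀ k : ℕ, (1 / 17 : ℝ) * ((-(3 / 4)) + (7 / 4 * (ε / q)) * (2 * (k : ℝ) - n)
      + (19 / 4 / q ^ 2) * (2 * (k : ℝ) - n) ^ 2 + (5 / 4 * (ε / q) ^ 3) * (2 * (k : ℝ) - n) ^ 3
      + (-1 / q ^ 4) * (2 * (k : ℝ) - n) ^ 4)
      ≤ if q / 4 ≤ ε * (2 * (k : ℝ) - n) then 1 else 0 := by
    intro k
    have hz := quartic_le_indicator ((ε / q) * (2 * (k : ℝ) - n))
    have hiff : (1 / 4 ≤ (ε / q) * (2 * (k : ℝ) - n)) ↔ q / 4 ≤ ε * (2 * (k : ℝ) - n) := by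
      rw [div_mul_eq_mul_div, le_div_iff₀ hq]
      constructor <;> intro h <;> linarith
    simp only [hiff] at hz
    have e2 : (ε / q) ^ 2 = 1 / q ^ 2 := by rw [div_pow, hε]
    have e4 : (ε / q) ^ 4 = 1 / q ^ 4 := by rw [div_pow, h4]
    have expand : ((ε / q) * (2 * (k : ℝ) - n) + 1) ^ 2 * ((ε / q) * (2 * (k : ℝ) - n) - 1 / 4)
        * (3 - (ε / q) * (2 * (k : ℝ) - n)) = (-(3 / 4)) + (7 / 4 * (ε / q)) * (2 * (k : ℝ) - n)
      + (19 / 4 / q ^ 2) * (2 * (k : ℝ) - n) ^ 2 + (5 / 4 * (ε / q) ^ 3) * (2 * (k : ℝ) - n) ^ 3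
      + (-1 / q ^ 4) * (2 * (k : ℝ) - n) ^ 4 := by
      have a2 : 19 / 4 / q ^ 2 = 19 / 4 * (ε / q) ^ 2 := by rw [e2]; ring
      have a4 : -1 / q ^ 4 = -(ε / q) ^ 4 := by rw [e4]; ring
      rw [a2, a4]
      ring
    rw [expand] at hz
    split_ifs at hz ⊢ <;> linarith
  refine le_trans ?_ (binAvg_mono n key)
  rw [binAvg_mul_left, binAvg_quartic, ← hq2]
  have e : -(3 / 4) + 19 / 4 / q ^ 2 * q ^ 2 + -1 / q ^ 4 * (3 * (q ^ 2) ^ 2 - 2 * q ^ 2)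
      = 1 + 2 / q ^ 2 := by
    field_simp
    ring
  rw [e]
  have : 0 ≤ 2 / q ^ 2 := by positivity
  linarith

/-- A lower tail of `s` blocks of `n` coins contains the event that every block is in its own
lower tail. -/
theorem pow_le_binAvg_blocks (n : ℕ) (w : ℝ) (s : ℕ) {p : ℝ} (hp : 0 ≤ p)
    (h : p ≤ binAvg n fun k => if (k : ℝ) ≤ w then 1 else 0) :
    p ^ s ≤ binAvg (s * n) fun k => if (k : ℝ) ≤ s * w then 1 else 0 := by
  induction s with
  | zero => simp [binAvg]
  | succ s ih =>
    rw [Nat.succ_mul, binAvg_nat_add]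
    calc p ^ (s + 1) = p ^ s * p := pow_succ _ _
      _ ≤ (binAvg (s * n) fun k => if (k : ℝ) ≤ s * w then 1 else 0)
          * binAvg n fun k => if (k : ℝ) ≤ w then 1 else 0 :=
          mul_le_mul ih h hp ((pow_nonneg hp s).trans ih)
      _ = binAvg (s * n) fun a => (binAvg n fun k => if (k : ℝ) ≤ w then (1 : ℝ) else 0) *
            if (a : ℝ) ≤ s * w then 1 else 0 := by
          rw [binAvg_mul_left, mul_comm]
      _ ≤ _ := by
          apply binAvg_mono
          intro a
          split_ifs with ha
          · rw [mul_one]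
            apply binAvg_mono
            intro k
            split_ifs with h1 h2 <;> push_cast at * <;> linarith
          · rw [mul_zero]
            refine (binAvg_const n 0).symm.le.trans (binAvg_mono n fun k => ?_)
            split_ifs <;> norm_num

theorem binAvg_eq_zero_indicator (n : ℕ) :
    binAvg n (fun k => if (k : ℝ) ≤ 0 then 1 else 0) = (1 / 2) ^ n := by
  induction n with
  | zero => simp [binAvg]
  | succ n ih =>
    have h : (fun k : ℕ => if ((k + 1 : ℕ) : ℝ) ≤ 0 then (1 : ℝ) else 0) = fun _ => 0 := by
      funext k
      rw [if_neg]
      exact not_le.2 (by positivity)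
    simp only [binAvg]
    rw [ih, h, binAvg_const, pow_succ]
    ring

theorem half_pow_le_binAvg_full (n : ℕ) :
    (1 / 2) ^ n ≤ binAvg n fun k => if (n : ℝ) ≤ k then (1 : ℝ) else 0 := by
  induction n with
  | zero => simp [binAvg]
  | succ n ih =>
    simp only [binAvg]
    have h1 : (0 : ℝ) ≤ binAvg n fun k => if ((n + 1 : ℕ) : ℝ) ≤ k then (1 : ℝ) else 0 := by
      refine (binAvg_const n 0).symm.le.trans (binAvg_mono n fun k => ?_)
      split_ifs <;> norm_num
    have h2 : (fun k : ℕ => if ((n + 1 : ℕ) : ℝ) ≤ ((k + 1 : ℕ) : ℝ) then (1 : ℝ) else 0)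
        = fun k : ℕ => if (n : ℝ) ≤ k then (1 : ℝ) else 0 := by
      funext k
      simp
    rw [h2, pow_succ]
    linarith

/-! ### Random sublists -/

/-- The average of `F` over all sublists of a list, with multiplicity. -/
noncomputable def sublistAvg {ι : Type*} : List ι → (List ι → ℝ) → ℝ
  | [], F => F []
  | v :: l, F => (sublistAvg l F + sublistAvg l fun σ => F (v :: σ)) / 2

theorem sublistAvg_mono {ι : Type*} (l : List ι) {F G : List ι → ℝ} (H : ∀ σ, F σ ≤ G σ) :
    sublistAvg l F ≤ sublistAvg l G := by
  induction l generalizing F G with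
  | nil => exact H []
  | cons v l ih =>
    have h1 := ih H
    have h2 := ih fun σ => H (v :: σ)
    simp only [sublistAvg]
    linarith

theorem sublistAvg_const {ι : Type*} (l : List ι) (c : ℝ) : sublistAvg l (fun _ => c) = c := by
  induction l with
  | nil => rfl
  | cons v l ih => simp only [sublistAvg, ih]; ring

theorem sublistAvg_add {ι : Type*} (l : List ι) (F G : List ι → ℝ) :
    sublistAvg l (fun σ => F σ + G σ) = sublistAvg l F + sublistAvg l G := by
  induction l generalizing F G with
  | nil => rfl
  | cons v l ih => simp only [sublistAvg, ih]; ring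

theorem sublistAvg_mul_left {ι : Type*} (l : List ι) (c : ℝ) (F : List ι → ℝ) :
    sublistAvg l (fun σ => c * F σ) = c * sublistAvg l F := by
  induction l generalizing F with
  | nil => rfl
  | cons v l ih => simp only [sublistAvg, ih]; ring

/-- In a random sublist the multiplicities of distinct elements are independent binomials. -/
theorem sublistAvg_prod_count {ι : Type*} [Fintype ι] [DecidableEq ι] (l : List ι)
    (g : ι → ℕ → ℝ) :
    sublistAvg l (fun σ => ∏ i, g i (σ.count i)) = ∏ i, binAvg (l.count i) (g i) := by
  induction l generalizing g with
  | nil => simp [sublistAvg, binAvg]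
  | cons v l ih =>
    -- Keeping the head `v` raises only the count of `v`, so it amounts to shifting the single
    -- function `g v`.
    have h : (fun σ : List ι => ∏ i, g i ((v :: σ).count i)) = fun σ : List ι =>
        ∏ i, (Function.update g v fun k => g v (k + 1)) i (σ.count i) := by
      funext σ
      refine Finset.prod_congr rfl fun i _ => ?_
      by_cases hi : i = v
      · subst hi; simp
      · simp [hi, List.count_cons_of_ne (Ne.symm hi)]
    simp only [sublistAvg]
    rw [h, ih, ih, ← Finset.mul_prod_erase _ _ (Finset.mem_univ v),
      ← Finset.mul_prod_erase _ (fun i => binAvg (l.count i) (Function.update g v _ i))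
        (Finset.mem_univ v),
      ← Finset.mul_prod_erase _ (fun i => binAvg ((v :: l).count i) (g i)) (Finset.mem_univ v)]
    have e1 : ∏ i ∈ Finset.univ.erase v,
        binAvg (l.count i) (Function.update g v (fun k => g v (k + 1)) i)
        = ∏ i ∈ Finset.univ.erase v, binAvg (l.count i) (g i) := by
      refine Finset.prod_congr rfl fun i hi => ?_
      simp [Finset.ne_of_mem_erase hi]
    have e2 : ∏ i ∈ Finset.univ.erase v, binAvg ((v :: l).count i) (g i)
        = ∏ i ∈ Finset.univ.erase v, binAvg (l.count i) (g i) := by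
      refine Finset.prod_congr rfl fun i hi => ?_
      rw [List.count_cons_of_ne (Finset.ne_of_mem_erase hi).symm]
    rw [e1, e2]
    simp only [Function.update_self, List.count_cons_self, binAvg]
    ring

theorem sublistAvg_count {ι : Type*} [DecidableEq ι] (l : List ι) (i : ι) (g : ℕ → ℝ) :
    sublistAvg l (fun σ => g (σ.count i)) = binAvg (l.count i) g := by
  induction l generalizing g with
  | nil => simp [sublistAvg, binAvg]
  | cons v l ih =>
    by_cases hi : i = v
    · subst hi
      simp only [sublistAvg, List.count_cons_self, binAvg, ih]
      rw [ih fun k => g (k + 1)]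
    · simp only [sublistAvg, List.count_cons_of_ne (Ne.symm hi), ih]
      ring

/-- A uniformly random sublist, with multiplicity. -/
noncomputable def randomSublist {ι : Type*} : List ι → PMF (List ι)
  | [] => PMF.pure []
  | v :: l => (PMF.uniformOfFintype Bool).bind fun c =>
      (randomSublist l).bind fun σ => PMF.pure (if c then v :: σ else σ)

theorem PMF.tsum_bind_mul {α β : Type*} (p : PMF α) (f : α → PMF β) (F : β → ℝ≥0∞) :
    ∑' y, p.bind f y * F y = ∑' x, p x * ∑' y, f x y * F y := by
  simp only [PMF.bind_apply, ← ENNReal.tsum_mul_right, ← ENNReal.tsum_mul_left, mul_assoc]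
  exact ENNReal.tsum_comm

theorem PMF.tsum_pure_mul {β : Type*} (a : β) (F : β → ℝ≥0∞) :
    ∑' y, PMF.pure a y * F y = F a := by
  rw [tsum_eq_single a]
  · simp
  · intro y hy
    simp [PMF.pure_apply, hy]

/-- Turns expectations in `[0, ∞]` into finite real averages, on which all later estimates are made.
-/
theorem tsum_randomSublist {ι : Type*} (l : List ι) (F : List ι → ℝ) (hF : ∀ σ, 0 ≤ F σ) :
    ∑' σ, randomSublist l σ * ENNReal.ofReal (F σ) = ENNReal.ofReal (sublistAvg l F) := by
  induction l generalizing F with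
  | nil => simp only [randomSublist, sublistAvg, PMF.tsum_pure_mul]
  | cons v l ih =>
    have nn : ∀ G : List ι → ℝ, (∀ σ, 0 ≤ G σ) → 0 ≤ sublistAvg l G := fun G hG =>
      (sublistAvg_const l 0).symm.le.trans (sublistAvg_mono l hG)
    simp only [randomSublist, sublistAvg, PMF.tsum_bind_mul, PMF.tsum_pure_mul]
    rw [tsum_bool, PMF.uniformOfFintype_apply, PMF.uniformOfFintype_apply]
    simp only [Bool.false_eq_true, if_false, if_true]
    rw [ih F hF, ih (fun σ => F (v :: σ)) fun σ => hF _, ← mul_add,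
      ← ENNReal.ofReal_add (nn _ hF) (nn _ fun σ => hF _), ENNReal.ofReal_div_of_pos two_pos]
    simp [ENNReal.div_eq_inv_mul]

/-- The list `0, …, b - 1` repeated `K` times. -/
def roundList (b : ℕ) : ℕ → List (Fin b)
  | 0 => []
  | K + 1 => List.finRange b ++ roundList b K

theorem count_roundList (b K : ℕ) (i : Fin b) : (roundList b K).count i = K := by
  induction K with
  | zero => rfl
  | succ K ih =>
    rw [roundList, List.count_append, ih,
      List.count_eq_one_of_mem (List.nodup_finRange b) (List.mem_finRange i), add_comm]

/-! ### Costs in a uniform system, and the online lower bound -/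

namespace UMTS

variable {b : ℕ} (U : UMTS b)

theorem d_nonneg (i j : Fin b) : 0 ≤ U.d i j := by
  let := U.metric
  exact dist_nonneg

theorem d_self (i : Fin b) : U.d i i = 0 := by
  let := U.metric
  exact dist_self i

theorem IsUniform.pos {U : UMTS b} {Δ : ℝ} (h : U.IsUniform Δ) (hb : 2 ≤ b) : 0 < Δ := by
  let := U.metric
  have hne : (⟨0, two_pos.trans_le hb⟩ : Fin b) ≠ ⟨1, by omega⟩ := by simp
  rw [← h _ _ hne]
  exact dist_pos.2 hne

theorem IsUniform.diam_eq {U : UMTS b} {Δ : ℝ} (h : U.IsUniform Δ) (hb : 2 ≤ b) :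
    U.diam = Δ := by
  have hΔ := h.pos hb
  let := U.metric
  have hne : (⟨0, two_pos.trans_le hb⟩ : Fin b) ≠ ⟨1, by omega⟩ := by simp
  apply le_antisymm
  · refine Metric.diam_le_of_forall_dist_le hΔ.le fun i _ j _ => ?_
    by_cases hij : i = j
    · subst hij
      rw [dist_self]
      exact hΔ.le
    · exact (h i j hij).le
  · rw [← h _ _ hne]
    exact Metric.dist_le_diam_of_mem (Set.toFinite _).isBounded (Set.mem_univ _) (Set.mem_univ _)

theorem offlineCost_cons (c : TaskVec b) (τ : List (TaskVec b)) (p : ℕ → Fin b) :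
    U.offlineCost (c :: τ) p
      = U.d (p 0) (p 1) + c (p 1) + U.offlineCost τ fun t => p (t + 1) := by
  unfold offlineCost
  exact Fin.sum_univ_succ _

theorem onlineCost_cons (c : TaskVec b) (τ : List (TaskVec b)) (p : ℕ → Fin b) :
    U.onlineCost (c :: τ) p = U.distRatio * U.d (p 0) (p 1) + U.costRatio (p 1) * c (p 1)
      + U.onlineCost τ fun t => p (t + 1) := by
  unfold onlineCost
  exact Fin.sum_univ_succ _

theorem offlineCost_const (τ : List (TaskVec b)) (u : Fin b) :
    U.offlineCost τ (fun _ => u) = (τ.map fun c => (c u : ℝ)).sum := by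
  induction τ with
  | nil => simp [offlineCost]
  | cons c τ ih => rw [offlineCost_cons, ih, d_self]; simp

theorem offlineCost_nonneg (τ : List (TaskVec b)) (p : ℕ → Fin b) : 0 ≤ U.offlineCost τ p :=
  Finset.sum_nonneg fun _ _ => add_nonneg (U.d_nonneg _ _) (NNReal.coe_nonneg _)

theorem onlineCost_nonneg (τ : List (TaskVec b)) (p : ℕ → Fin b) : 0 ≤ U.onlineCost τ p :=
  Finset.sum_nonneg fun _ _ => add_nonneg (mul_nonneg U.distRatio_pos.le (U.d_nonneg _ _))
    (mul_nonneg (U.costRatio_pos _).le (NNReal.coe_nonneg _))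

theorem opt0_nonneg (τ : List (TaskVec b)) (u : Fin b) : 0 ≤ U.opt0 τ u :=
  Real.iInf_nonneg fun p => add_nonneg (U.offlineCost_nonneg τ p.1) (U.d_nonneg _ _)

theorem opt0_le (τ : List (TaskVec b)) (p : ℕ → Fin b) :
    U.opt0 τ (p 0) ≤ U.offlineCost τ p + U.d (p τ.length) (p 0) :=
  ciInf_le (f := fun q : {q : ℕ → Fin b // q 0 = p 0} =>
      U.offlineCost τ q.1 + U.d (q.1 τ.length) (p 0))
    ⟨0, by
      rintro _ ⟨q, rfl⟩
      exact add_nonneg (U.offlineCost_nonneg τ q.1) (U.d_nonneg _ _)⟩ ⟨p, rfl⟩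

/-- Staying at the initial point is an offline strategy. -/
theorem opt0_le_stay (τ : List (TaskVec b)) (u : Fin b) :
    U.opt0 τ u ≤ (τ.map fun c => (c u : ℝ)).sum := by
  have h := U.opt0_le τ fun _ => u
  rwa [offlineCost_const, d_self, add_zero] at h

/-- Moving at once to a point, staying there and finally returning is an offline strategy. -/
theorem opt0_le_move (τ : List (TaskVec b)) (u i : Fin b) :
    U.opt0 τ u ≤ (τ.map fun c => (c i : ℝ)).sum + (U.d u i + U.d i u) := by
  cases τ with
  | nil =>
    refine (U.opt0_le_stay [] u).trans ?_
    have h1 := U.d_nonneg u i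
    have h2 := U.d_nonneg i u
    simp only [List.map_nil, List.sum_nil]
    linarith
  | cons c τ =>
    have h := U.opt0_le (c :: τ) fun t => if t = 0 then u else i
    rw [offlineCost_cons] at h
    simp only [Nat.add_eq_zero_iff, one_ne_zero, and_false, if_false, if_true, List.length_cons,
      offlineCost_const] at h
    simp only [List.map_cons, List.sum_cons]
    linarith

/-- The elementary task at `i` whose online cost is the diameter. -/
noncomputable def hitTask (i : Fin b) : ElementaryTask b :=
  ⟨i, Real.toNNReal ((U.costRatio i)⁻¹ * U.diam)⟩

theorem diam_nonneg : 0 ≤ U.diam := by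
  let := U.metric
  exact Metric.diam_nonneg

theorem hitTask_size (i : Fin b) :
    ((U.hitTask i).size : ℝ) = (U.costRatio i)⁻¹ * U.diam :=
  Real.coe_toNNReal _ (mul_nonneg (inv_nonneg.2 (U.costRatio_pos i).le) U.diam_nonneg)

/-- The task vector of `hitTask`. -/
noncomputable def hitVec (i : Fin b) : TaskVec b := (U.hitTask i).toTask

theorem hitVec_self (i : Fin b) : (U.hitVec i i : ℝ) = (U.costRatio i)⁻¹ * U.diam := by
  rw [← hitTask_size]
  simp [hitVec, ElementaryTask.toTask, hitTask]

theorem hitVec_of_ne {i j : Fin b} (h : j ≠ i) : (U.hitVec i j : ℝ) = 0 := by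
  simp [hitVec, ElementaryTask.toTask, hitTask, h]

theorem sum_hitVec (σ : List (Fin b)) (i : Fin b) :
    ((σ.map U.hitVec).map fun c => (c i : ℝ)).sum
      = U.diam * (σ.count i / U.costRatio i) := by
  induction σ with
  | nil => simp
  | cons v σ ih =>
    simp only [List.map_cons, List.sum_cons, ih]
    by_cases h : i = v
    · subst h
      rw [hitVec_self, List.count_cons_self]
      push_cast
      ring
    · rw [hitVec_of_ne U h, List.count_cons_of_ne (Ne.symm h), zero_add]

/-- The online cost of an algorithm whose position is a function of the points hit so far. -/
noncomputable def walkCost : List (Fin b) → (List (Fin b) → Fin b) → ℝ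
  | [], _ => 0
  | v :: σ, f => U.distRatio * U.d (f []) (f [v]) + U.costRatio (f [v]) * U.hitVec v (f [v])
      + walkCost σ fun τ => f (v :: τ)

/-- After a first hit the algorithm is again a function of the later hits, so `walkCost` permits
induction along the hit list. -/
theorem onlineCost_eq_walkCost (σ : List (Fin b)) (g : List (TaskVec b) → Fin b) :
    U.onlineCost (σ.map U.hitVec) (fun t => g ((σ.map U.hitVec).take t))
      = U.walkCost σ fun τ => g (τ.map U.hitVec) := by
  induction σ generalizing g with
  | nil => exact Fin.sum_univ_zero _
  | cons v σ ih =>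
    rw [List.map_cons, onlineCost_cons, walkCost]
    simp only [List.take_succ_cons, List.take_zero, List.map_cons, List.map_nil]
    rw [ih fun τ => g (U.hitVec v :: τ)]

theorem walkCost_step_nonneg (u v w : Fin b) :
    0 ≤ U.distRatio * U.d u w + U.costRatio w * U.hitVec v w :=
  add_nonneg (mul_nonneg U.distRatio_pos.le (U.d_nonneg _ _))
    (mul_nonneg (U.costRatio_pos _).le (NNReal.coe_nonneg _))

variable {U} in
theorem IsUniform.diam_le_step_of_ne (h : U.IsUniform U.diam) (hs : U.distRatio = 1)
    {u w : Fin b} (v : Fin b) (hw : u ≠ w) :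
    U.diam ≤ U.distRatio * U.d u w + U.costRatio w * U.hitVec v w := by
  rw [hs, one_mul, h u w hw]
  exact le_add_of_nonneg_right (mul_nonneg (U.costRatio_pos _).le (NNReal.coe_nonneg _))

variable {U} in
theorem IsUniform.diam_le_step_hit (h : U.IsUniform U.diam) (hs : U.distRatio = 1)
    (u w : Fin b) : U.diam ≤ U.distRatio * U.d u w + U.costRatio w * U.hitVec u w := by
  by_cases hw : u = w
  · subst hw
    rw [hitVec_self, d_self, mul_inv_cancel_left₀ (U.costRatio_pos u).ne']
    linarith
  · exact h.diam_le_step_of_ne hs u hw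

variable {U} in
/-- If the coins of the points in `p` are tossed, the current position among them, then the
expected cost is at least half of the diameter on top of the later cost. -/
theorem IsUniform.le_avg_walkCost_append (h : U.IsUniform U.diam) (hs : U.distRatio = 1)
    {l : List (Fin b)} {m : ℝ} (hm : ∀ f, m ≤ sublistAvg l fun σ => U.walkCost σ f)
    (p : List (Fin b)) (f : List (Fin b) → Fin b) :
    m ≤ sublistAvg (p ++ l) (fun σ => U.walkCost σ f) ∧
      (f [] ∈ p → m + U.diam / 2 ≤ sublistAvg (p ++ l) fun σ => U.walkCost σ f) := by
  induction p generalizing f with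
  | nil => exact ⟨hm f, fun h => by simp at h⟩
  | cons v p ih =>
    have e : sublistAvg (v :: p ++ l) (fun σ => U.walkCost σ f)
        = (sublistAvg (p ++ l) (fun σ => U.walkCost σ f)
          + ((U.distRatio * U.d (f []) (f [v]) + U.costRatio (f [v]) * U.hitVec v (f [v]))
          + sublistAvg (p ++ l) fun σ => U.walkCost σ fun τ => f (v :: τ))) / 2 := by
      simp only [List.cons_append, sublistAvg, walkCost]
      rw [sublistAvg_add, sublistAvg_const]
    have hΔ := U.diam_nonneg
    have hstep := U.walkCost_step_nonneg (f []) v (f [v])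
    obtain ⟨h1, h1'⟩ := ih f
    obtain ⟨h2, h2'⟩ := ih fun τ => f (v :: τ)
    rw [e]
    refine ⟨by linarith, fun hf => ?_⟩
    -- If the coin is that of the current position, heads costs a full diameter, by the hit or by a
    -- move, which averages to one half. Otherwise, after tails or after heads without a move, the
    -- current position is still among the remaining points; after heads with a move the diameter
    -- has already been paid.
    by_cases hv : f [] = v
    · have := h.diam_le_step_hit hs (f []) (f [v])
      rw [hv] at this hstep ⊢
      linarith
    · have hp : f [] ∈ p := (List.mem_cons.1 hf).resolve_left hv
      have h3 := h1' hp
      by_cases hm : f [] = f [v]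
      · have h4 := h2' (hm ▸ hp)
        linarith
      · have := h.diam_le_step_of_ne hs v hm
        linarith

-- A round contains every point, so the current position is always among those whose coins are still
-- to be tossed.
variable {U} in
theorem IsUniform.le_avg_walkCost (h : U.IsUniform U.diam) (hs : U.distRatio = 1) (K : ℕ)
    (f : List (Fin b) → Fin b) :
    K / 2 * U.diam ≤ sublistAvg (roundList b K) fun σ => U.walkCost σ f := by
  induction K generalizing f with
  | zero => simp [roundList, sublistAvg, walkCost]
  | succ K ih =>
    have := (h.le_avg_walkCost_append hs ih (List.finRange b) f).2 (List.mem_finRange _)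
    rw [roundList]
    refine le_trans (le_of_eq ?_) this
    push_cast
    ring

/-- In each of `K` rounds, every point is hit with probability one half, independently. -/
noncomputable def coinAdversary (K : ℕ) : PMF (List (ElementaryTask b)) :=
  (randomSublist (roundList b K)).bind fun σ => PMF.pure (σ.map U.hitTask)

theorem expectedCost_coinAdversary (K : ℕ) (cost : List (TaskVec b) → ℝ)
    (h : ∀ τ, 0 ≤ cost τ) :
    expectedCost (U.coinAdversary K) cost
      = ENNReal.ofReal (sublistAvg (roundList b K) fun σ => cost (σ.map U.hitVec)) := by
  unfold expectedCost coinAdversary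
  rw [PMF.tsum_bind_mul, ← tsum_randomSublist _ _ fun σ => h _]
  refine tsum_congr fun σ => ?_
  rw [PMF.tsum_pure_mul, List.map_map]
  rfl

theorem size_eq_of_mem_coinAdversary {K : ℕ} {σ : List (ElementaryTask b)}
    (hσ : σ ∈ (U.coinAdversary K).support) {e : ElementaryTask b} (he : e ∈ σ) :
    (e.size : ℝ) = (U.costRatio e.point)⁻¹ * U.diam := by
  rw [coinAdversary, PMF.mem_support_bind_iff] at hσ
  obtain ⟨τ, -, hτ⟩ := hσ
  rw [PMF.mem_support_pure_iff] at hτ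
  subst hτ
  obtain ⟨i, -, rfl⟩ := List.mem_map.1 he
  exact U.hitTask_size i

variable {U} in
/-- A bound on the average offline cost makes `coinAdversary` a discrete adversary. -/
theorem IsUniform.isDiscreteAdversary {Δ : ℝ} (h : U.IsUniform Δ) (hb : 2 ≤ b)
    (hs : U.distRatio = 1) {K : ℕ} {r β : ℝ} (hβ : 0 < β) (hr : r * β ≤ K / 2) (u : Fin b)
    {F : List (Fin b) → ℝ}
    (hF : ∀ σ, U.opt0 (σ.map U.hitVec) u ≤ U.diam * F σ)
    (hopt : sublistAvg (roundList b K) F ≤ β) :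
    U.IsDiscreteAdversary r β (fun i => (U.costRatio i)⁻¹) (U.coinAdversary K) := by
  have hd := h.diam_eq hb
  have hΔ : 0 < U.diam := hd ▸ h.pos hb
  rw [← hd] at h
  refine ⟨⟨hΔ, hβ, ?_, fun A => le_iInf fun u₀ => ?_⟩, fun σ hσ e he =>
    U.size_eq_of_mem_coinAdversary hσ he⟩
  · refine (iInf_le _ u).trans ?_
    rw [expectedCost_coinAdversary _ _ _ fun τ => U.opt0_nonneg τ u]
    refine ENNReal.ofReal_le_ofReal ((sublistAvg_mono _ hF).trans ?_)
    rw [sublistAvg_mul_left, mul_comm]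
    exact mul_le_mul_of_nonneg_right hopt hΔ.le
  · rw [expectedCost_coinAdversary _ _ (fun σ => U.algCost A σ u₀)
      fun τ => U.onlineCost_nonneg τ _]
    refine ENNReal.ofReal_le_ofReal ?_
    have := h.le_avg_walkCost hs K fun τ => A.state u₀ (τ.map U.hitVec)
    simp only [algCost, onlineCost_eq_walkCost]
    refine le_trans ?_ this
    rw [← mul_assoc]
    exact mul_le_mul_of_nonneg_right hr hΔ.le

end UMTS

/-! ### Offline savings from atypical hit counts -/

theorem binAvg_ite_mem_Icc (n : ℕ) (q : ℕ → Prop) [DecidablePred q] :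
    0 ≤ binAvg n (fun k => if q k then 1 else 0) ∧
      binAvg n (fun k => if q k then 1 else 0) ≤ 1 := by
  constructor
  · refine (binAvg_const n 0).symm.le.trans (binAvg_mono n fun k => ?_)
    split_ifs <;> norm_num
  · refine (binAvg_mono n fun k => ?_).trans (binAvg_const n 1).le
    split_ifs <;> norm_num

/-- Bernoulli's inequality for `(1 + p) ^ n`, combined with `(1 - p) ^ n * (1 + p) ^ n ≤ 1`. -/
theorem one_sub_pow_le_inv {p : ℝ} {n : ℕ} (h0 : 0 ≤ p) (h1 : p ≤ 1) :
    (1 - p) ^ n ≤ 1 / (1 + n * p) := by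
  rw [le_div_iff₀ (by positivity)]
  have h2 : 1 + n * p ≤ (1 + p) ^ n := one_add_mul_le_pow (by linarith) n
  calc (1 - p) ^ n * (1 + n * p) ≤ (1 - p) ^ n * (1 + p) ^ n :=
        mul_le_mul_of_nonneg_left h2 (pow_nonneg (by linarith) n)
    _ = (1 - p ^ 2) ^ n := by rw [← mul_pow]; ring
    _ ≤ 1 := pow_le_one₀ (by nlinarith) (by nlinarith)

/-- Evaluates the joint probabilities below: the first point plays its own role, the next `k` are
alike, and the others are ignored. -/
theorem Fin.prod_univ_ite_le {b k : ℕ} (hk : k < b) (X Y : ℝ) :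
    ∏ i : Fin b, (if (i : ℕ) = 0 then X else if (i : ℕ) ≤ k then Y else 1) = X * Y ^ k := by
  obtain ⟨m, rfl⟩ : ∃ m, b = m + 1 := ⟨b - 1, by omega⟩
  rw [Fin.prod_univ_eq_prod_range (fun i => if i = 0 then X else if i ≤ k then Y else 1) (m + 1),
    Finset.prod_range_succ']
  simp only [Nat.add_eq_zero_iff, one_ne_zero, and_false, if_false, if_true]
  rw [← Finset.prod_subset (s₁ := Finset.range k) (Finset.range_subset_range.2 (by omega)),
    Finset.prod_congr rfl (g := fun _ => Y), Finset.prod_const, Finset.card_range, mul_comm]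
  · intro i hi
    rw [if_pos]
    have := Finset.mem_range.1 hi
    omega
  · intro i _ hi
    rw [if_neg]
    rw [Finset.mem_range] at hi
    omega

namespace UMTS

variable {b : ℕ} {U : UMTS b}

theorem opt0_hitVec_le_stay (σ : List (Fin b)) (u : Fin b) :
    U.opt0 (σ.map U.hitVec) u ≤ U.diam * (σ.count u / U.costRatio u) := by
  have := U.opt0_le_stay (σ.map U.hitVec) u
  rwa [sum_hitVec] at this

theorem IsUniform.opt0_hitVec_le_move (h : U.IsUniform U.diam) (σ : List (Fin b))
    {u i : Fin b} (hi : i ≠ u) :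
    U.opt0 (σ.map U.hitVec) u ≤ U.diam * (σ.count i / U.costRatio i + 2) := by
  have := U.opt0_le_move (σ.map U.hitVec) u i
  rw [sum_hitVec, h _ _ hi, h _ _ hi.symm] at this
  linarith

/-- If the point of largest cost ratio is hit at least `a` times while another of the first `k + 1`
points is hit at most `w` times, then moving there saves an offline player at least one diameter. -/
theorem IsUniform.exists_adversary_of_tails {Δ : ℝ} (h : U.IsUniform Δ) (hb : 2 ≤ b)
    (hs : U.distRatio = 1) (hr : Antitone U.costRatio) {K k : ℕ} (hK : 0 < K) (hkb : k < b)
    {R a w p₁ p₂ : ℝ} (hR : U.costRatio ⟨0, two_pos.trans_le hb⟩ = R) (hp₁ : 0 ≤ p₁)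
    (ha : p₁ ≤ binAvg K fun n => if a ≤ n then 1 else 0) (hp₂ : 0 ≤ p₂)
    (hw : p₂ ≤ binAvg K fun n => if (n : ℝ) ≤ w then 1 else 0)
    (haw : 3 ≤ a / R - w / U.costRatio ⟨k, hkb⟩) :
    ∃ β, U.IsDiscreteAdversary (R + 2 * R ^ 2 * (p₁ * (1 - (1 - p₂) ^ k)) / K) β
      (fun i => (U.costRatio i)⁻¹) (U.coinAdversary K) ∧ β ≤ K / (2 * R) := by
  classical
  have hd := h.diam_eq hb
  have hΔ : 0 < U.diam := hd ▸ h.pos hb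
  have h' := h
  rw [← hd] at h'
  have hR0 : 0 < R := hR ▸ U.costRatio_pos _
  have hK0 : (0 : ℝ) < K := by exact_mod_cast hK
  obtain ⟨-, hA1⟩ := binAvg_ite_mem_Icc K fun n => a ≤ (n : ℝ)
  obtain ⟨-, hW1⟩ := binAvg_ite_mem_Icc K fun n => (n : ℝ) ≤ w
  set A := binAvg K fun n => if a ≤ (n : ℝ) then 1 else 0 with hA
  set W := binAvg K fun n => if (n : ℝ) ≤ w then 1 else 0 with hW
  set u : Fin b := ⟨0, two_pos.trans_le hb⟩ with hu
  have hp₂1 : p₂ ≤ 1 := hw.trans hW1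
  set G := p₁ * (1 - (1 - p₂) ^ k) with hG
  have hpow : (1 - p₂) ^ k ≤ 1 := pow_le_one₀ (by linarith) (by linarith)
  have hG0 : 0 ≤ G := mul_nonneg hp₁ (by linarith)
  have hGA : G ≤ A * (1 - (1 - W) ^ k) := by
    have : (1 - W) ^ k ≤ (1 - p₂) ^ k := pow_le_pow_left₀ (by linarith) (by linarith) k
    exact mul_le_mul ha (by linarith) (by linarith) (hp₁.trans ha)
  -- The guaranteed saving `G` relative to the cost `K / (2 * R)` of staying.
  set y := 2 * R * G / K with hy
  have hy0 : 0 ≤ y := by positivity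
  set g : Fin b → ℕ → ℝ := fun i n => if (i : ℕ) = 0 then (if a ≤ (n : ℝ) then 1 else 0)
    else if (i : ℕ) ≤ k then 1 - (if (n : ℝ) ≤ w then 1 else 0) else 1 with hg
  have hg0 : ∀ i n, 0 ≤ g i n := by
    intro i n
    simp only [hg]
    split_ifs <;> norm_num
  -- The product of the `g i` indicates that the first point is hit at least `a` times and none of
  -- the next `k` at most `w` times. So `F` is the cost of staying, minus 1 exactly when moving pays
  -- off.
  set F : List (Fin b) → ℝ := fun σ => R⁻¹ * (σ.count u : ℝ)
    + ((-1) * (if a ≤ (σ.count u : ℝ) then 1 else 0) + ∏ i, g i (σ.count i)) with hF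
  have havg : sublistAvg (roundList b K) F = K / (2 * R) - A * (1 - (1 - W) ^ k) := by
    rw [hF, sublistAvg_add, sublistAvg_mul_left, sublistAvg_add, sublistAvg_mul_left,
      sublistAvg_count _ u fun n => (n : ℝ),
      sublistAvg_count _ u fun n => if a ≤ (n : ℝ) then 1 else 0,
      sublistAvg_prod_count, count_roundList, binAvg_cast, ← hA]
    have : ∏ i, binAvg ((roundList b K).count i) (g i) = A * (1 - W) ^ k := by
      rw [← Fin.prod_univ_ite_le hkb]
      refine Finset.prod_congr rfl fun i _ => ?_
      rw [count_roundList]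
      by_cases h0 : (i : ℕ) = 0
      · simp only [hg, h0, if_true, hA]
      · by_cases h1 : (i : ℕ) ≤ k
        · simp only [hg, h0, h1, if_true, if_false]
          rw [binAvg_const_sub]
        · simp only [hg, h0, h1, if_false]
          rw [binAvg_const]
    rw [this]
    field_simp
    ring
  -- This `β` makes `r * β = K / 2` exactly, and dominates the average offline cost because `(1 - y)
  -- * (1 + y) ≤ 1`.
  refine ⟨K / (2 * R) / (1 + y), h.isDiscreteAdversary hb hs (by positivity) ?_ u (F := F) ?_ ?_,
    div_le_self (by positivity) (by linarith)⟩
  · have e : R + 2 * R ^ 2 * G / K = R * (1 + y) := by rw [hy]; ring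
    rw [e]
    have : 1 + y ≠ 0 := by positivity
    apply le_of_eq
    field_simp
  · intro σ
    have hprod0 : 0 ≤ ∏ i, g i (σ.count i) := Finset.prod_nonneg fun i _ => hg0 _ _
    have hstay := opt0_hitVec_le_stay (U := U) σ u
    rw [hR, div_eq_inv_mul] at hstay
    by_cases hau : a ≤ (σ.count u : ℝ)
    · by_cases hex : ∃ i : Fin b, (i : ℕ) ≠ 0 ∧ (i : ℕ) ≤ k ∧ (σ.count i : ℝ) ≤ w
      · obtain ⟨i, hi0, hik, hiw⟩ := hex
        have hiu : i ≠ u := fun hc => hi0 (by rw [hc])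
        refine (h'.opt0_hitVec_le_move σ hiu).trans (mul_le_mul_of_nonneg_left ?_ hΔ.le)
        have h1 : (σ.count i : ℝ) / U.costRatio i ≤ w / U.costRatio ⟨k, hkb⟩ :=
          div_le_div₀ ((Nat.cast_nonneg _).trans hiw) hiw (U.costRatio_pos _) (hr hik)
        have h2 : a / R ≤ R⁻¹ * (σ.count u : ℝ) := by
          rw [← div_eq_inv_mul]
          exact div_le_div_of_nonneg_right hau hR0.le
        simp only [hF, if_pos hau]
        linarith
      · refine hstay.trans (mul_le_mul_of_nonneg_left ?_ hΔ.le)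
        have : ∏ i, g i (σ.count i) = 1 := by
          refine Finset.prod_eq_one fun i _ => ?_
          push Not at hex
          by_cases h0 : (i : ℕ) = 0
          · have : i = u := Fin.ext h0
            subst this
            simp only [hg, h0, if_true, if_pos hau]
          · by_cases h1 : (i : ℕ) ≤ k
            · simp only [hg, h0, h1, if_true, if_false, if_neg (not_le.2 (hex i h0 h1)), sub_zero]
            · simp only [hg, h0, h1, if_false]
        simp only [hF, if_pos hau, this]
        linarith
    · refine hstay.trans (mul_le_mul_of_nonneg_left ?_ hΔ.le)
      simp only [hF, if_neg hau]
      linarith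
  · rw [havg, le_div_iff₀ (by positivity)]
    have e : K / (2 * R) * y = G := by
      rw [hy]
      field_simp
    have h1 : (K / (2 * R) - A * (1 - (1 - W) ^ k)) * (1 + y) ≤ (K / (2 * R) - G) * (1 + y) := by
      gcongr
    have h2 : 0 ≤ G * y := by positivity
    nlinarith

/-- With `K` rounds and `K * 2 ^ K` at most the number of points, some point is likely not hit. -/
theorem IsUniform.exists_adversary_of_pow_le {Δ : ℝ} (h : U.IsUniform Δ) (hb : 2 ≤ b)
    (hs : U.distRatio = 1) (hr1 : ∀ i, 1 ≤ U.costRatio i) {K : ℕ} (hKb : K * 2 ^ K ≤ b) :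
    U.IsDiscreteAdversary (K / 6) 3 (fun i => (U.costRatio i)⁻¹) (U.coinAdversary K) := by
  classical
  have hd := h.diam_eq hb
  have hΔ : 0 < U.diam := hd ▸ h.pos hb
  have h' := h
  rw [← hd] at h'
  set u : Fin b := ⟨0, two_pos.trans_le hb⟩ with hu
  -- The product of the `g i` is the count of the first point if all other points are hit, and 0
  -- otherwise. In the latter case moving to an unhit point and back costs only 2 diameters.
  set g : Fin b → ℕ → ℝ := fun i n => if (i : ℕ) = 0 then (n : ℝ)
    else if (i : ℕ) ≤ b - 1 then 1 - (if (n : ℝ) ≤ 0 then 1 else 0) else 1 with hg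
  have hg0 : ∀ i n, 0 ≤ g i n := by
    intro i n
    simp only [hg]
    split_ifs <;> norm_num
  refine h.isDiscreteAdversary hb hs (by norm_num) (by linarith) u
    (F := fun σ => 2 + ∏ i, g i (σ.count i)) (fun σ => ?_) ?_
  · have hprod0 : 0 ≤ ∏ i, g i (σ.count i) := Finset.prod_nonneg fun i _ => hg0 _ _
    by_cases hex : ∃ i : Fin b, i ≠ u ∧ σ.count i = 0
    · obtain ⟨i, hiu, hi⟩ := hex
      refine (h'.opt0_hitVec_le_move σ hiu).trans (mul_le_mul_of_nonneg_left ?_ hΔ.le)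
      rw [hi]
      simpa using hprod0
    · push Not at hex
      refine (opt0_hitVec_le_stay σ u).trans (mul_le_mul_of_nonneg_left ?_ hΔ.le)
      have hprod : ∏ i, g i (σ.count i) = σ.count u := by
        rw [Finset.prod_eq_single u]
        · simp [hg, hu]
        · intro i _ hi
          have hi0 : (i : ℕ) ≠ 0 := fun hc => hi (Fin.ext hc)
          have hpos : ¬ ((σ.count i : ℝ) ≤ 0) := by
            have := hex i hi
            exact not_le.2 (by positivity)
          simp only [hg, hi0, if_false, if_neg hpos, sub_zero, ite_self]
        · simp
      rw [hprod]
      have : (σ.count u : ℝ) / U.costRatio u ≤ σ.count u :=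
        div_le_self (Nat.cast_nonneg _) (hr1 u)
      linarith
  · rw [sublistAvg_add, sublistAvg_const, sublistAvg_prod_count]
    have e : ∏ i, binAvg ((roundList b K).count i) (g i)
        = (K / 2 : ℝ) * (1 - (1 / 2) ^ K) ^ (b - 1) := by
      rw [← Fin.prod_univ_ite_le (by omega : b - 1 < b)]
      refine Finset.prod_congr rfl fun i _ => ?_
      rw [count_roundList]
      by_cases h0 : (i : ℕ) = 0
      · simp only [hg, h0, if_true, binAvg_cast]
      · have h1 : (i : ℕ) ≤ b - 1 := by omega
        simp only [hg, h0, h1, if_true, if_false]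
        rw [binAvg_const_sub, binAvg_eq_zero_indicator]
    rw [e]
    have hq : (0 : ℝ) < (1 / 2) ^ K := by positivity
    have hq1 : ((1 / 2 : ℝ)) ^ K ≤ 1 := pow_le_one₀ (by norm_num) (by norm_num)
    have hle := one_sub_pow_le_inv (n := b - 1) hq.le hq1
    have hb1 : (b : ℝ) / 2 ≤ ((b - 1 : ℕ) : ℝ) := by
      rw [Nat.cast_sub (by omega)]
      have : (2 : ℝ) ≤ b := by exact_mod_cast hb
      push_cast
      linarith
    have hKb' : (K : ℝ) * 2 ^ K ≤ b := by exact_mod_cast hKb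
    have hK2 : (K : ℝ) ≤ b * (1 / 2) ^ K := by
      rw [one_div, inv_pow, ← div_eq_mul_inv, le_div_iff₀ (by positivity)]
      exact hKb'
    -- The expected number of unhit points other than the first is at least `b * 2 ^ (-K) / 2`,
    -- hence at least `K / 2`.
    have hfin : (K / 2 : ℝ) ≤ 1 * (1 + ((b - 1 : ℕ) : ℝ) * (1 / 2) ^ K) := by nlinarith
    have : (K / 2 : ℝ) * (1 - (1 / 2) ^ K) ^ (b - 1) ≤ 1 := by
      calc (K / 2 : ℝ) * (1 - (1 / 2) ^ K) ^ (b - 1)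
          ≤ K / 2 * (1 / (1 + ((b - 1 : ℕ) : ℝ) * (1 / 2) ^ K)) := by gcongr
        _ = K / 2 / (1 + ((b - 1 : ℕ) : ℝ) * (1 / 2) ^ K) := by ring
        _ ≤ 1 := (div_le_iff₀ (by positivity)).2 hfin
    linarith

end UMTS

/-! ### Two choices of the thresholds -/

namespace UMTS

variable {b : ℕ} {U : UMTS b}

/-- The adversary with `s` blocks of about `(32 R / s) ^ 2` rounds each. -/
theorem IsUniform.exists_adversary_of_blocks {Δ : ℝ} (h : U.IsUniform Δ) (hb : 2 ≤ b)
    (hs : U.distRatio = 1) (hr : Antitone U.costRatio) {s k : ℕ} (hs0 : 0 < s) (hkb : k < b)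
    {R x : ℝ} (hR : U.costRatio ⟨0, two_pos.trans_le hb⟩ = R) (hx : U.costRatio ⟨k, hkb⟩ = R - x)
    (hx0 : 0 ≤ x) (hsR : s ≤ 10 * R) (hxs : 1124 * x ≤ s) :
    ∃ (r β : ℝ) (D : PMF (List (ElementaryTask b))),
      U.IsDiscreteAdversary r β (fun i => (U.costRatio i)⁻¹) D ∧ β ≤ 600 * R ∧
      R + s / 9554 * (k * (1 / 17) ^ s / (1 + k * (1 / 17) ^ s)) ≤ r := by
  have hR0 : 0 < R := hR ▸ U.costRatio_pos _
  have hr0 : 0 < R - x := hx ▸ U.costRatio_pos _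
  have hs0' : (0 : ℝ) < s := by exact_mod_cast hs0
  have hs1 : (1 : ℝ) ≤ s := by exact_mod_cast hs0
  set B := ⌈(32 * R / s) ^ 2⌉₊ with hB
  have hB0 : 0 < B := Nat.ceil_pos.2 (by positivity)
  have hBle : (B : ℝ) ≤ (32 * R / s) ^ 2 + 1 := (Nat.ceil_lt_add_one (by positivity)).le
  have hBsqrt : 32 * R / s ≤ √(B : ℝ) := Real.le_sqrt_of_sq_le (Nat.le_ceil _)
  have hsB : 32 * R ≤ s * √(B : ℝ) := by
    rw [div_le_iff₀ hs0'] at hBsqrt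
    linarith
  have hK0 : 0 < s * B := Nat.mul_pos hs0 hB0
  have hK0' : (0 : ℝ) < ((s * B : ℕ) : ℝ) := by exact_mod_cast hK0
  -- The constant is `32 ^ 2 + 10 ^ 2`; the second term pays for rounding `B` up.
  have hKs : ((s * B : ℕ) : ℝ) * s ≤ 1124 * R ^ 2 := by
    push_cast
    calc (s : ℝ) * B * s = s ^ 2 * B := by ring
      _ ≤ s ^ 2 * ((32 * R / s) ^ 2 + 1) := by gcongr
      _ = 1024 * R ^ 2 + s ^ 2 := by field_simp; ring
      _ ≤ 1024 * R ^ 2 + (10 * R) ^ 2 := by gcongr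
      _ = 1124 * R ^ 2 := by ring
  have hupper : (1 / 17 : ℝ) ≤ binAvg (s * B) fun n =>
      if ((s * B : ℕ) : ℝ) / 2 ≤ n then 1 else 0 := by
    refine (binAvg_tail (s * B) hK0 1 (by norm_num)).trans (binAvg_mono _ fun n => ?_)
    have := Real.sqrt_nonneg ((s * B : ℕ) : ℝ)
    split_ifs <;> linarith
  -- Each block falls short of its mean by `√B / 8`, in total at least `4 * R` by `hsB`.
  have hlower : (1 / 17 : ℝ) ^ s ≤ binAvg (s * B) fun n =>
      if (n : ℝ) ≤ s * ((B : ℝ) / 2 - √B / 8) then 1 else 0 := by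
    refine pow_le_binAvg_blocks B _ s (by norm_num)
      ((binAvg_tail B hB0 (-1) (by norm_num)).trans (binAvg_mono _ fun n => ?_))
    split_ifs <;> linarith
  have hKx : ((s * B : ℕ) : ℝ) * x ≤ R ^ 2 := by nlinarith
  -- The shortfall is worth 4 diameters at ratio `R`; the smaller ratio `R - x` loses at most one of
  -- them, since `K * x ≤ R ^ 2`. Of the remaining three, two pay for the moves.
  have hgap : 3 ≤ ((s * B : ℕ) : ℝ) / 2 / R
      - s * ((B : ℝ) / 2 - √B / 8) / U.costRatio ⟨k, hkb⟩ := by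
    rw [hx]
    have h1 : s * ((B : ℝ) / 2 - √B / 8) / (R - x)
        ≤ (((s * B : ℕ) : ℝ) / 2 - 4 * R) / (R - x) := by
      apply div_le_div_of_nonneg_right _ hr0.le
      push_cast
      linarith
    have h2 : (((s * B : ℕ) : ℝ) / 2 - 4 * R) / (R - x) ≤ ((s * B : ℕ) : ℝ) / 2 / R - 3 := by
      have e : ((s * B : ℕ) : ℝ) / 2 / R - 3 = (((s * B : ℕ) : ℝ) / 2 - 3 * R) / R := by
        field_simp
      rw [e, div_le_div_iff₀ hr0 hR0]
      nlinarith [mul_nonneg hR0.le hx0]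
    linarith
  obtain ⟨β, hD, hβ⟩ := h.exists_adversary_of_tails hb hs hr hK0 hkb hR (by norm_num) hupper
    (by positivity) hlower hgap
  refine ⟨_, β, _, hD, hβ.trans ?_, ?_⟩
  · rw [div_le_iff₀ (by positivity)]
    nlinarith
  · have hp0 : (0 : ℝ) < (1 / 17) ^ s := by positivity
    have hp1 : (1 / 17 : ℝ) ^ s ≤ 1 := pow_le_one₀ (by norm_num) (by norm_num)
    have hpow := one_sub_pow_le_inv (n := k) hp0.le hp1
    set p : ℝ := (1 / 17) ^ s
    have hkp : (0 : ℝ) ≤ k * p := by positivity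
    have e1 : k * p / (1 + k * p) = 1 - 1 / (1 + k * p) := by field_simp; ring
    have hq : 0 ≤ k * p / (1 + k * p) := by positivity
    have h1 : (s : ℝ) / 1124 ≤ R ^ 2 / ((s * B : ℕ) : ℝ) := by
      rw [div_le_div_iff₀ (by norm_num) hK0']
      linarith
    have h2 : (1 / 17 : ℝ) * (k * p / (1 + k * p)) ≤ 1 / 17 * (1 - (1 - p) ^ k) := by
      rw [e1]
      linarith
    have h3 : (s : ℝ) / 1124 * (1 / 17 * (k * p / (1 + k * p)))
        ≤ R ^ 2 / ((s * B : ℕ) : ℝ) * (1 / 17 * (1 - (1 - p) ^ k)) :=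
      mul_le_mul h1 h2 (by positivity) (by positivity)
    have e2 : 2 * R ^ 2 * (1 / 17 * (1 - (1 - p) ^ k)) / ((s * B : ℕ) : ℝ)
        = 2 * (R ^ 2 / ((s * B : ℕ) : ℝ) * (1 / 17 * (1 - (1 - p) ^ k))) := by ring
    rw [e2]
    linarith

/-- The adversary that gains only when the first point is always hit and another one never. -/
theorem IsUniform.exists_adversary_of_extremes {Δ : ℝ} (h : U.IsUniform Δ) (hb : 2 ≤ b)
    (hs : U.distRatio = 1) (hr : Antitone U.costRatio) {R : ℝ}
    (hR : U.costRatio ⟨0, two_pos.trans_le hb⟩ = R) (hR1 : 1 ≤ R) :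
    ∃ (r β : ℝ) (D : PMF (List (ElementaryTask b))),
      U.IsDiscreteAdversary r β (fun i => (U.costRatio i)⁻¹) D ∧ β ≤ 600 * R ∧
      R + 1 / 2 * Real.exp (-(8 * R)) ≤ r := by
  -- The fewest rounds in which hitting the first point every time costs 3 diameters.
  set K := ⌈3 * R⌉₊ with hK
  have hK0 : 0 < K := Nat.ceil_pos.2 (by positivity)
  have hK0' : (0 : ℝ) < K := by exact_mod_cast hK0
  have hK3 : 3 * R ≤ K := Nat.le_ceil _
  have hK4 : (K : ℝ) ≤ 4 * R := by
    have := (Nat.ceil_lt_add_one (a := 3 * R) (by positivity)).le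
    linarith
  obtain ⟨β, hD, hβ⟩ := h.exists_adversary_of_tails hb hs hr (K := K) (k := 1) hK0 (by omega) hR
    (a := K) (w := 0) (by positivity) (half_pow_le_binAvg_full K) (by positivity)
    (binAvg_eq_zero_indicator K).symm.le (by
      rw [zero_div, sub_zero, le_div_iff₀ (by linarith)]
      exact hK3)
  refine ⟨_, β, _, hD, hβ.trans ?_, ?_⟩
  · rw [div_le_iff₀ (by positivity)]
    nlinarith
  · have e : 2 * R ^ 2 * ((1 / 2) ^ K * (1 - (1 - (1 / 2 : ℝ) ^ K) ^ 1)) / K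
        = 2 * R ^ 2 / K * (1 / 4) ^ K := by
      rw [pow_one, sub_sub_cancel, ← mul_pow]
      ring_nf
    rw [e]
    have h1 : (1 : ℝ) / 2 ≤ 2 * R ^ 2 / K := by
      rw [div_le_div_iff₀ (by norm_num) hK0']
      nlinarith
    have h2 : Real.exp (-(8 * R)) ≤ (1 / 4 : ℝ) ^ K := by
      have h4 : Real.exp (-2) ≤ 1 / 4 := by
        rw [Real.exp_neg, ← one_div]
        apply one_div_le_one_div_of_le (by norm_num)
        have := Real.add_one_le_exp 1
        have e2 : Real.exp 2 = Real.exp 1 * Real.exp 1 := by rw [← Real.exp_add]; norm_num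
        rw [e2]
        nlinarith
      calc Real.exp (-(8 * R)) ≤ Real.exp (K * (-2)) := Real.exp_le_exp.2 (by linarith)
        _ = Real.exp (-2) ^ K := Real.exp_nat_mul _ _
        _ ≤ (1 / 4) ^ K := pow_le_pow_left₀ (Real.exp_pos _).le h4 K
    have := mul_le_mul h1 h2 (Real.exp_pos _).le (by positivity)
    linarith

end UMTS

/-! ### Reduction to one index and choice of the number of blocks -/

theorem sum_range_one_div_sq_le (m : ℕ) :
    ∑ i ∈ Finset.range m, 1 / ((i : ℝ) + 2) ^ 2 ≤ 1 - 1 / ((m : ℝ) + 1) := by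
  induction m with
  | zero => simp
  | succ m ih =>
    rw [Finset.sum_range_succ]
    have : 1 / ((m : ℝ) + 2) ^ 2 ≤ 1 / (m + 1) - 1 / (m + 2) := by
      rw [div_sub_div _ _ (by positivity) (by positivity),
        div_le_div_iff₀ (by positivity) (by positivity)]
      nlinarith [(Nat.cast_nonneg m : (0 : ℝ) ≤ m)]
    push_cast
    have e : (m : ℝ) + 1 + 1 = m + 2 := by ring
    rw [e]
    linarith

/-- A sum of positive terms is controlled by its first term and one further weighted term. -/
theorem exists_sum_le_add_sq_mul {b : ℕ} (hb : 2 ≤ b) (E : Fin b → ℝ) (hE : ∀ i, 0 < E i) :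
    ∃ k : Fin b, 1 ≤ (k : ℕ) ∧ ∑ i, E i ≤ E ⟨0, two_pos.trans_le hb⟩ + ((k : ℝ) + 1) ^ 2 * E k := by
  obtain ⟨m, rfl⟩ : ∃ m, b = m + 1 := ⟨b - 1, by omega⟩
  have : Nonempty (Fin m) := ⟨⟨0, by omega⟩⟩
  -- Maximizing the term weighted by the square of its 1-based position bounds every other term by
  -- `M / (j + 2) ^ 2`, and these weights sum to at most 1.
  obtain ⟨k, hk⟩ := Finite.exists_max fun j : Fin m => ((j : ℝ) + 2) ^ 2 * E j.succ
  refine ⟨k.succ, by simp, ?_⟩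
  set M := ((k : ℝ) + 2) ^ 2 * E k.succ with hM
  have hM0 : 0 < M := mul_pos (by positivity) (hE _)
  have e : (((k.succ : Fin (m + 1)) : ℕ) : ℝ) + 1 = k + 2 := by
    rw [Fin.val_succ]
    push_cast
    ring
  rw [e, ← hM, Fin.sum_univ_succ]
  have h1 : ∑ j : Fin m, E j.succ ≤ ∑ j : Fin m, M * (1 / ((j : ℝ) + 2) ^ 2) := by
    refine Finset.sum_le_sum fun j _ => ?_
    rw [mul_one_div, le_div_iff₀ (by positivity), mul_comm]
    exact hk j
  have h2 : ∑ j : Fin m, M * (1 / ((j : ℝ) + 2) ^ 2) ≤ M := by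
    rw [← Finset.mul_sum, Fin.sum_univ_eq_sum_range (fun j => 1 / ((j : ℝ) + 2) ^ 2) m]
    have h3 := sum_range_one_div_sq_le m
    have h4 : (0 : ℝ) ≤ 1 / (m + 1) := by positivity
    nlinarith
  have h0 : (0 : Fin (m + 1)) = ⟨0, two_pos.trans_le hb⟩ := rfl
  rw [h0]
  linarith

theorem exp_neg_three_le : Real.exp (-3) ≤ 1 / 17 := by
  rw [Real.exp_neg, ← one_div]
  apply one_div_le_one_div_of_le (by norm_num)
  have h := Real.exp_one_gt_d9.le
  have e : Real.exp 3 = Real.exp 1 ^ 3 := by rw [← Real.exp_nat_mul]; norm_num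
  rw [e]
  calc (17 : ℝ) ≤ 2.7182818283 ^ 3 := by norm_num
    _ ≤ _ := by gcongr

theorem one_div_le_exp_neg_three : 1 / 21 ≤ Real.exp (-3) := by
  rw [Real.exp_neg, ← one_div]
  apply one_div_le_one_div_of_le (Real.exp_pos _)
  have h := Real.exp_one_lt_d9.le
  have e : Real.exp 3 = Real.exp 1 ^ 3 := by rw [← Real.exp_nat_mul]; norm_num
  rw [e]
  calc Real.exp 1 ^ 3 ≤ 2.7182818286 ^ 3 := by gcongr
    _ ≤ _ := by norm_num

/-- Uses `exp (-3) ≤ 1 / 17`; the factor 21, an upper bound for `exp 3`, absorbs the rounding of `s`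
by at most 1. -/
theorem exp_le_one_div_seventeen_pow {s : ℕ} {y : ℝ} (h : s ≤ y + 1) :
    Real.exp (-(3 * y)) / 21 ≤ (1 / 17) ^ s := by
  calc Real.exp (-(3 * y)) / 21 = Real.exp (-(3 * y)) * (1 / 21) := by ring
    _ ≤ Real.exp (-(3 * y)) * Real.exp (-3) := by
      gcongr
      exact one_div_le_exp_neg_three
    _ = Real.exp (-(3 * y) + -3) := (Real.exp_add _ _).symm
    _ ≤ Real.exp (s * (-3)) := Real.exp_le_exp.2 (by linarith)
    _ = Real.exp (-3) ^ s := Real.exp_nat_mul _ _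
    _ ≤ (1 / 17) ^ s := pow_le_pow_left₀ (Real.exp_pos _).le exp_neg_three_le s

theorem div_one_add_le_div_one_add {a c : ℝ} (ha : 0 ≤ a) (hac : a ≤ c) :
    a / (1 + a) ≤ c / (1 + c) := by
  rw [div_le_div_iff₀ (by linarith) (by linarith)]
  linarith

namespace UMTS

variable {b : ℕ} {U : UMTS b}

/-- Three regimes of the deficit `x`, relative to `R` and to `L = log (k + 1)`. The tiny `ρ` makes
`exp (-x / ρ)` decay much faster than the probabilities of the events exploited. -/
theorem IsUniform.exists_adversary_of_index {Δ : ℝ} (h : U.IsUniform Δ) (hb : 2 ≤ b)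
    (hs : U.distRatio = 1) (hr : Antitone U.costRatio) {R : ℝ}
    (hR : U.costRatio ⟨0, two_pos.trans_le hb⟩ = R) (hR1 : 1 ≤ R) (hlog : Real.log b ≤ 50 * R)
    {k : Fin b} (hk : 1 ≤ (k : ℕ)) {ρ : ℝ} (hρ : ρ = 1 / 10 ^ 8) :
    ∃ (r β : ℝ) (D : PMF (List (ElementaryTask b))),
      U.IsDiscreteAdversary r β (fun i => (U.costRatio i)⁻¹) D ∧ β ≤ 600 * R ∧
      R + ρ * Real.log (1 + ((k : ℝ) + 1) ^ 2 * Real.exp (-(ρ⁻¹ * (R - U.costRatio k)))) ≤ r := by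
  obtain ⟨x, hx⟩ : ∃ x, x = R - U.costRatio k := ⟨_, rfl⟩
  have hx' : U.costRatio ⟨k, k.2⟩ = R - x := by rw [hx]; simp
  have hx0 : 0 ≤ x := by
    rw [hx, ← hR, sub_nonneg]
    exact hr (Fin.mk_le_of_le_val (Nat.zero_le _))
  have hρ0 : 0 < ρ := by rw [hρ]; positivity
  have hρi : ρ⁻¹ = 10 ^ 8 := by rw [hρ]; norm_num
  rw [← hx]
  have hk1 : (1 : ℝ) ≤ k := by exact_mod_cast hk
  set L := Real.log ((k : ℝ) + 1) with hL
  have hL0 : 0 ≤ L := Real.log_nonneg (by linarith)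
  have hLexp : Real.exp L = (k : ℝ) + 1 := Real.exp_log (by linarith)
  have hLR : L ≤ 50 * R := by
    refine le_trans (Real.log_le_log (by linarith) ?_) hlog
    exact_mod_cast k.2
  have hT : ((k : ℝ) + 1) ^ 2 * Real.exp (-(ρ⁻¹ * x)) = Real.exp (2 * L - 10 ^ 8 * x) := by
    rw [← hLexp, ← Real.exp_nat_mul, ← Real.exp_add, hρi]
    congr 1
  have hlogT : ρ * Real.log (1 + ((k : ℝ) + 1) ^ 2 * Real.exp (-(ρ⁻¹ * x)))
      ≤ ρ * Real.exp (2 * L - 10 ^ 8 * x) := by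
    rw [hT]
    have := Real.log_le_sub_one_of_pos
      (by positivity : 0 < 1 + Real.exp (2 * L - 10 ^ 8 * x))
    apply mul_le_mul_of_nonneg_left _ hρ0.le
    linarith
  -- Here `2 * L ≤ 100 * R` is negligible against `10 ^ 8 * x`. In the other case `x ≤ R / 200`
  -- keeps `s` below `10 * R`.
  by_cases hfar : R / 200 < x
  · obtain ⟨r, β, D, hD, hβ, hrr⟩ := h.exists_adversary_of_extremes hb hs hr hR hR1
    refine ⟨r, β, D, hD, hβ, le_trans ?_ hrr⟩
    have h1 : Real.exp (2 * L - 10 ^ 8 * x) ≤ Real.exp (-(8 * R)) :=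
      Real.exp_le_exp.2 (by linarith)
    have h2 : ρ * Real.exp (2 * L - 10 ^ 8 * x) ≤ 1 / 2 * Real.exp (-(8 * R)) :=
      mul_le_mul (by rw [hρ]; norm_num) h1 (Real.exp_pos _).le (by norm_num)
    linarith
  push Not at hfar
  by_cases hxL : x ≤ 3 * ρ * L
  · set s := ⌊L / 6⌋₊ + 1 with hs'
    have hs_le : (s : ℝ) ≤ L / 6 + 1 := by
      rw [hs']
      push_cast
      have := Nat.floor_le (by positivity : 0 ≤ L / 6)
      linarith
    have hs_ge : L / 6 ≤ s := by
      rw [hs']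
      push_cast
      exact (Nat.lt_floor_add_one _).le
    obtain ⟨r, β, D, hD, hβ, hrr⟩ := h.exists_adversary_of_blocks hb hs hr (s := s)
      (Nat.succ_pos _) k.2 hR hx' hx0 (by linarith)
      (by rw [hρ] at hxL; linarith)
    refine ⟨r, β, D, hD, hβ, le_trans ?_ hrr⟩
    have hp := exp_le_one_div_seventeen_pow hs_le
    have hkp : (1 / 42 : ℝ) ≤ k * (1 / 17) ^ s := by
      have h1 : Real.exp L / 2 ≤ k := by rw [hLexp]; linarith
      have h2 : (1 : ℝ) ≤ Real.exp L * Real.exp (-(3 * (L / 6))) := by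
        rw [← Real.exp_add]
        exact Real.one_le_exp (by linarith)
      calc (1 / 42 : ℝ) ≤ Real.exp L / 2 * (Real.exp (-(3 * (L / 6))) / 21) := by linarith
        _ ≤ _ := by gcongr
    have hfrac := div_one_add_le_div_one_add (by norm_num) hkp
    have hgain : L / 6 / 9554 * (1 / 43) ≤
        s / 9554 * (k * (1 / 17) ^ s / (1 + k * (1 / 17) ^ s)) := by
      refine mul_le_mul (by linarith) (le_trans (by norm_num) hfrac) (by norm_num) (by positivity)
    have hlog3 : Real.log (1 + ((k : ℝ) + 1) ^ 2 * Real.exp (-(ρ⁻¹ * x))) ≤ 3 * L := by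
      have e : 3 * L = Real.log (((k : ℝ) + 1) ^ 3) := by
        rw [Real.log_pow, ← hL]
        norm_num
      rw [e]
      apply Real.log_le_log (by positivity)
      have h1 : Real.exp (-(ρ⁻¹ * x)) ≤ 1 := Real.exp_le_one_iff.2 (by
        have : 0 ≤ ρ⁻¹ * x := by positivity
        linarith)
      calc 1 + ((k : ℝ) + 1) ^ 2 * Real.exp (-(ρ⁻¹ * x)) ≤ 1 + ((k : ℝ) + 1) ^ 2 * 1 := by gcongr
        _ ≤ _ := by nlinarith
    have hfin : ρ * Real.log (1 + ((k : ℝ) + 1) ^ 2 * Real.exp (-(ρ⁻¹ * x))) ≤ ρ * (3 * L) :=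
      mul_le_mul_of_nonneg_left hlog3 hρ0.le
    have : ρ * (3 * L) ≤ L / 6 / 9554 * (1 / 43) := by
      rw [hρ]
      linarith
    linarith
  · push Not at hxL
    -- The least order of `s` that tolerates the deficit `x`. The gain is of order `exp (-3372 *
    -- x)`, whereas `2 * L < 2 * x / (3 * ρ)` leaves the target below `ρ * exp (-x / (3 * ρ))`.
    set s := ⌊1124 * x⌋₊ + 1 with hs'
    have hs_le : (s : ℝ) ≤ 1124 * x + 1 := by
      rw [hs']
      push_cast
      have := Nat.floor_le (by positivity : 0 ≤ 1124 * x)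
      linarith
    have hs_ge : 1124 * x ≤ s := by
      rw [hs']
      push_cast
      exact (Nat.lt_floor_add_one _).le
    have hs_one : (1 : ℝ) ≤ s := by exact_mod_cast Nat.succ_pos _
    obtain ⟨r, β, D, hD, hβ, hrr⟩ := h.exists_adversary_of_blocks hb hs hr (s := s)
      (Nat.succ_pos _) k.2 hR hx' hx0 (by linarith) hs_ge
    refine ⟨r, β, D, hD, hβ, le_trans ?_ hrr⟩
    have hp := exp_le_one_div_seventeen_pow hs_le
    have hp0 : (0 : ℝ) < (1 / 17) ^ s := by positivity
    have hp1 : (1 / 17 : ℝ) ^ s ≤ 1 := pow_le_one₀ (by norm_num) (by norm_num)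
    have hfrac := div_one_add_le_div_one_add hp0.le (le_mul_of_one_le_left hp0.le hk1)
    have hhalf : (1 / 17 : ℝ) ^ s / 2 ≤ (1 / 17) ^ s / (1 + (1 / 17) ^ s) := by
      gcongr
      linarith
    have hgain : 1 / 9554 * (Real.exp (-(3 * (1124 * x))) / 21 / 2) ≤
        s / 9554 * (k * (1 / 17) ^ s / (1 + k * (1 / 17) ^ s)) := by
      refine mul_le_mul (by linarith) (by linarith) (by positivity) (by positivity)
    have h1 : Real.exp (2 * L - 10 ^ 8 * x) ≤ Real.exp (-(3 * (1124 * x))) :=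
      Real.exp_le_exp.2 (by rw [hρ] at hxL; linarith)
    have h2 : ρ * Real.exp (2 * L - 10 ^ 8 * x)
        ≤ 1 / (9554 * 42) * Real.exp (-(3 * (1124 * x))) :=
      mul_le_mul (by rw [hρ]; norm_num) h1 (Real.exp_pos _).le (by norm_num)
    linarith

/-- The adversary for large cost ratios. -/
theorem IsUniform.exists_adversary_of_log_le {Δ : ℝ} (h : U.IsUniform Δ) (hb : 2 ≤ b)
    (hs : U.distRatio = 1) (hr : Antitone U.costRatio) (hr1 : ∀ i, 1 ≤ U.costRatio i)
    (hlog : Real.log b ≤ 50 * U.costRatio ⟨0, two_pos.trans_le hb⟩) {ρ : ℝ} (hρ : ρ = 1 / 10 ^ 8) :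
    ∃ (r β : ℝ) (D : PMF (List (ElementaryTask b))),
      U.IsDiscreteAdversary r β (fun i => (U.costRatio i)⁻¹) D ∧
      β ≤ 600 * U.costRatio ⟨0, two_pos.trans_le hb⟩ ∧
      ρ * Real.log (∑ i, Real.exp (ρ⁻¹ * U.costRatio i)) ≤ r := by
  have hρ0 : 0 < ρ := by rw [hρ]; positivity
  obtain ⟨R, hR⟩ : ∃ R, U.costRatio ⟨0, two_pos.trans_le hb⟩ = R := ⟨_, rfl⟩
  obtain ⟨k, hk, hsum⟩ := exists_sum_le_add_sq_mul hb (fun i => Real.exp (ρ⁻¹ * U.costRatio i))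
    fun i => Real.exp_pos _
  obtain ⟨r, β, D, hD, hβ, hrr⟩ :=
    h.exists_adversary_of_index hb hs hr hR (hR ▸ hr1 _) (hR ▸ hlog) hk hρ
  refine ⟨r, β, D, hD, hR ▸ hβ, le_trans ?_ hrr⟩
  simp only [hR] at hsum
  have e : Real.exp (ρ⁻¹ * R) + ((k : ℝ) + 1) ^ 2 * Real.exp (ρ⁻¹ * U.costRatio k)
      = Real.exp (ρ⁻¹ * R)
        * (1 + ((k : ℝ) + 1) ^ 2 * Real.exp (-(ρ⁻¹ * (R - U.costRatio k)))) := by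
    have : Real.exp (ρ⁻¹ * U.costRatio k)
        = Real.exp (ρ⁻¹ * R) * Real.exp (-(ρ⁻¹ * (R - U.costRatio k))) := by
      rw [← Real.exp_add]
      congr 1
      ring
    rw [this]
    ring
  have hne : Nonempty (Fin b) := ⟨⟨0, two_pos.trans_le hb⟩⟩
  have hpos : 0 < ∑ i, Real.exp (ρ⁻¹ * U.costRatio i) :=
    Finset.sum_pos (fun i _ => Real.exp_pos _) Finset.univ_nonempty
  calc ρ * Real.log (∑ i, Real.exp (ρ⁻¹ * U.costRatio i))
      ≤ ρ * Real.log (Real.exp (ρ⁻¹ * R)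
        * (1 + ((k : ℝ) + 1) ^ 2 * Real.exp (-(ρ⁻¹ * (R - U.costRatio k))))) := by
        apply mul_le_mul_of_nonneg_left _ hρ0.le
        exact Real.log_le_log hpos (hsum.trans e.le)
    _ = R + ρ * Real.log (1 + ((k : ℝ) + 1) ^ 2 * Real.exp (-(ρ⁻¹ * (R - U.costRatio k)))) := by
        rw [Real.log_mul (Real.exp_pos _).ne' (by positivity), Real.log_exp, mul_add,
          mul_inv_cancel_left₀ hρ0.ne']

/-- The adversary for cost ratios that are small compared with the logarithm of the size. -/
theorem IsUniform.exists_adversary_of_lt_log {Δ : ℝ} (h : U.IsUniform Δ) (hb : 2 ≤ b)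
    (hs : U.distRatio = 1) (hr1 : ∀ i, 1 ≤ U.costRatio i)
    (hlog : 50 * U.costRatio ⟨0, two_pos.trans_le hb⟩ < Real.log b) :
    ∃ (r : ℝ) (D : PMF (List (ElementaryTask b))),
      U.IsDiscreteAdversary r 3 (fun i => (U.costRatio i)⁻¹) D ∧
      1 / 20 * Real.log b ≤ r := by
  have hR1 := hr1 ⟨0, two_pos.trans_le hb⟩
  have hb0 : (0 : ℝ) < b := by
    have : 0 < b := by omega
    exact_mod_cast this
  -- Both `K` and `2 ^ K` are at most `exp K`, so their product is at most `exp (2 * K) ≤ b`.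
  set K := ⌊Real.log b / 2⌋₊ with hK
  have hK1 : (K : ℝ) ≤ Real.log b / 2 := Nat.floor_le (by linarith)
  have hK2 : Real.log b / 2 < K + 1 := Nat.lt_floor_add_one _
  have hKb : K * 2 ^ K ≤ b := by
    have h1 : (K : ℝ) ≤ Real.exp K := by
      have := Real.add_one_le_exp (K : ℝ)
      linarith
    have h2 : (2 : ℝ) ^ K ≤ Real.exp K := by
      have := Real.add_one_le_exp (1 : ℝ)
      calc (2 : ℝ) ^ K ≤ Real.exp 1 ^ K := pow_le_pow_left₀ (by norm_num) (by linarith) K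
        _ = Real.exp K := by rw [← Real.exp_nat_mul, mul_one]
    have h3 : (K : ℝ) * 2 ^ K ≤ b := by
      calc (K : ℝ) * 2 ^ K ≤ Real.exp K * Real.exp K := by gcongr
        _ = Real.exp (K + K) := (Real.exp_add _ _).symm
        _ ≤ Real.exp (Real.log b) := Real.exp_le_exp.2 (by linarith)
        _ = b := Real.exp_log hb0
    exact_mod_cast h3
  exact ⟨_, _, h.exists_adversary_of_pow_le hb hs hr1 hKb, by linarith⟩

end UMTS

/-! ### Assembly of both claims -/

theorem mainTheorem4 :
    ∃ lam₃ ρ : ℝ, 0 < lam₃ ∧ 0 < ρ ∧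
      ∀ (b : ℕ) (hb : 2 ≤ b) (Δ : ℝ) (U : UMTS b),
        U.IsUniform Δ → U.distRatio = 1 →
        Antitone U.costRatio → (∀ i, 1 ≤ U.costRatio i) →
        ((1 / 4 * Real.log b ≤ U.costRatio ⟨0, by omega⟩ →
            ∃ (r β : ℝ) (D : PMF (List (ElementaryTask b))),
              U.IsDiscreteAdversary r β (fun i => (U.costRatio i)⁻¹) D ∧
              β ≤ lam₃ * U.costRatio ⟨0, by omega⟩ ∧
              ρ * Real.log (∑ i, Real.exp (ρ⁻¹ * U.costRatio i)) ≤ r) ∧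
          ∀ n : Fin b → ℝ, (∀ i, 0 < n i) →
            (∀ i, U.costRatio i = ρ * (1 + Real.log (n i))) →
            ∃ (r β : ℝ) (α : Fin b → ℝ) (D : PMF (List (ElementaryTask b))),
              U.IsDiscreteAdversary r β α D ∧
              ρ * (1 + Real.log (∑ i, n i)) ≤ r ∧
              β ≤ lam₃ * U.costRatio ⟨0, by omega⟩ ∧
              ∀ i, (U.costRatio ⟨0, by omega⟩)⁻¹ ≤ α i) := by
  refine ⟨600, 1 / 10 ^ 8, by norm_num, by norm_num, ?_⟩
  generalize hρ : (1 / 10 ^ 8 : ℝ) = ρ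
  intro b hb Δ U h hs hr hr1
  have hρ0 : 0 < ρ := by rw [← hρ]; norm_num
  have hR1 := hr1 ⟨0, by omega⟩
  -- The hypothesis of (a) gives `log b ≤ 4 * R`, well inside the range `log b ≤ 50 * R`; the wider
  -- range leaves (b) only very large `b` to treat separately.
  refine ⟨fun hlog => h.exists_adversary_of_log_le hb hs hr hr1 (by linarith) hρ.symm,
    fun n hn hrn => ?_⟩
  have hmin : ∀ i, (U.costRatio ⟨0, by omega⟩)⁻¹ ≤ (U.costRatio i)⁻¹ := fun i =>
    inv_anti₀ (U.costRatio_pos i) (hr (Fin.mk_le_of_le_val (Nat.zero_le _)))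
  have hne : Nonempty (Fin b) := ⟨⟨0, by omega⟩⟩
  have hsum : 0 < ∑ i, n i := Finset.sum_pos (fun i _ => hn i) Finset.univ_nonempty
  by_cases hlog : Real.log b ≤ 50 * U.costRatio ⟨0, by omega⟩
  · obtain ⟨r, β, D, hD, hβ, hrr⟩ := h.exists_adversary_of_log_le hb hs hr hr1 hlog hρ.symm
    refine ⟨r, β, _, D, hD, le_trans (le_of_eq ?_) hrr, hβ, hmin⟩
    -- Here `exp (r_i / ρ) = e * n_i`, so the bounds of (a) and (b) coincide.
    have e : ∑ i, Real.exp (ρ⁻¹ * U.costRatio i) = Real.exp 1 * ∑ i, n i := by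
      rw [Finset.mul_sum]
      refine Finset.sum_congr rfl fun i _ => ?_
      rw [hrn i, inv_mul_cancel_left₀ hρ0.ne', Real.exp_add, Real.exp_log (hn i)]
    rw [e, Real.log_mul (Real.exp_pos _).ne' hsum.ne', Real.log_exp]
  · push Not at hlog
    obtain ⟨r, D, hD, hrr⟩ := h.exists_adversary_of_lt_log hb hs hr1 hlog
    refine ⟨r, 3, _, D, hD, le_trans ?_ hrr, by linarith, hmin⟩
    -- The largest ratio belongs to the largest `n i`, so the target is at most `ρ * log b + R`, and
    -- each summand is at most `log b / 50`.
    have hle : ∑ i, n i ≤ b * n ⟨0, by omega⟩ := by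
      have : ∀ i ∈ Finset.univ, n i ≤ n ⟨0, by omega⟩ := by
        intro i _
        have h1 : U.costRatio i ≤ U.costRatio ⟨0, by omega⟩ :=
          hr (Fin.mk_le_of_le_val (Nat.zero_le _))
        rw [hrn i, hrn ⟨0, by omega⟩, mul_le_mul_iff_right₀ hρ0, add_le_add_iff_left] at h1
        exact (Real.log_le_log_iff (hn _) (hn _)).1 h1
      have := Finset.sum_le_card_nsmul _ _ _ this
      simpa using this
    have hb0 : (0 : ℝ) < b := by
      have : 0 < b := by omega
      exact_mod_cast this
    have h1 := Real.log_le_log hsum hle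
    rw [Real.log_mul hb0.ne' (hn _).ne'] at h1
    have h2 := hrn ⟨0, by omega⟩
    have h3 : ρ * (1 + Real.log (∑ i, n i))
        ≤ ρ * Real.log b + ρ * (1 + Real.log (n ⟨0, by omega⟩)) := by
      rw [← mul_add]
      apply mul_le_mul_of_nonneg_left _ hρ0.le
      linarith
    rw [← h2] at h3
    have h4 : ρ * Real.log b ≤ 1 / 50 * Real.log b :=
      mul_le_mul_of_nonneg_right (by rw [← hρ]; norm_num) (by linarith)
    linarith
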